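/- **Setting.** For integers $p\ge 1$, $q\ge 0$ and $d=p+q$ let $\mathbf I_{p,q}=\operatorname{diag}(1,\dots,1,-1,\dots,-1)$ ($p$ ones, $q$ minus ones), let $\mathbb O_d$ be the orthogonal group and $\mathbb O_{p,q}=\{\mathbf Q\in\mathbb R^{d\times d}:\mathbf Q\mathbf I_{p,q}\mathbf Q^T=\mathbf I_{p,q}\}$. For $\mathbf X,\mathbf Y\in\mathbb R^{n\times d}$ write $\mathbf X\sim\mathbf Y$ if $\mathbf Y=\mathbf X\mathbf Q$ for some $\mathbf Q\in\mathbb O_{p,q}$, and let $[\mathbf X]$ be the class of $\mathbf X$. Let $\mathcal X_n^{(p,q)}$ be the set of $\mathbf X\in\mathbb R^{n\times d}$ such that all entries of $\mathbf X\mathbf I_{p,q}\mathbf X^T$ lie in $[0,1]$. Let $\mathcal S_d(\mathbb R^n)=\{\mathbf U\in\mathbb R^{n\times d}:\mathbf U^T\mathbf U=\mathbf I_d\}$. If $\mathbf U_{\mathbf X},\mathbf U_{\mathbf Y}\in\mathcal S_d(\mathbb R^n)$ and $\boldsymbol\Lambda_{\mathbf X},\boldsymbol\Lambda_{\mathbf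 Y}$ are diagonal with positive diagonal entries such that $\mathbf U_{\mathbf X}\boldsymbol\Lambda_{\mathbf X}^{1/2}\in[\mathbf X]$ and $\mathbf U_{\mathbf Y}\boldsymbol\Lambda_{\mathbf Y}^{1/2}\in[\mathbf Y]$, define $$\tilde d_{2,\infty}([\mathbf X],[\mathbf Y])=\min_{\mathbf W\in\mathbb O_d\cap\mathbb O_{p,q}}\bigl\|\mathbf U_{\mathbf X}\boldsymbol\Lambda_{\mathbf X}^{1/2}-\mathbf U_{\mathbf Y}\boldsymbol\Lambda_{\mathbf Y}^{1/2}\mathbf W\bigr\|_{2,\infty},$$ where $\|\cdot\|_{2,\infty}$ is the largest Euclidean norm of a row (the value does not depend on the choice of $\mathbf U$ and $\boldsymbol\Lambda$). For $\kappa_\star,\lambda_\star>0$ let $\mathcal C(\kappa_\star,\lambda_\star)$ be the set of $\boldsymbol\Lambda=\operatorname{diag}(\lambda_1,\dots,\lambda_d)$ with $\lambda_1\ge\dots\ge\lambda_d\ge\lambda_\star$ and $\lambda_1/\lambda_d\le\kappa_\star$, and let $$\mathcal P(\kappa_\star,\lambda_\star,p,q)=\{(\mathbf U,\boldsymbol\Lambda):\mathbf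 U\in\mathcal S_d(\mathbb R^n),\ \boldsymbol\Lambda\in\mathcal C(\kappa_\star,\lambda_\star),\ \mathbf U\boldsymbol\Lambda^{1/2}\in\mathcal X_n^{(p,q)}\}.$$ Under the parameter $(\mathbf U,\boldsymbol\Lambda)$ one observes the symmetric adjacency matrix $\mathbf A\in\{0,1\}^{n\times n}$ (with zero diagonal) whose entries $\mathbf A_{ij}\sim\operatorname{Bern}(\mathbf P_{ij})$, $i<j$, are independent, where $\mathbf P=\mathbf U\boldsymbol\Lambda^{1/2}\mathbf I_{p,q}\boldsymbol\Lambda^{1/2}\mathbf U^T$. **Theorem.** Let $p=p_n\ge 1$, $q=q_n\ge 0$, $d=d_n=p_n+q_n$, $\kappa_\star=\kappa_{\star,n}$ and $\lambda_\star=\lambda_{\star,n}>0$ be sequences such that $\kappa_\star=o(n)$ and, for all large $n$, $\kappa_\star\ge 3d$ and $3\kappa_\star\lambda_\star\le n$. If $d=1$ is allowed, suppose also that $\kappa_\star$ is bounded along the indices $n$ with $d_n=1$. Then there is a constant $c>0$, not depending on $n$, such that for all sufficiently large $n$ $$\inf_{(\hat{\mathbf U},\hat{\boldsymbol\Lambda})}\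 \sup_{(\mathbf U,\boldsymbol\Lambda)\in\mathcal P(\kappa_\star,\lambda_\star,p,q)}\mathbb E\,\tilde d_{2,\infty}\bigl([\hat{\mathbf U}\hat{\boldsymbol\Lambda}^{1/2}],[\mathbf U\boldsymbol\Lambda^{1/2}]\bigr)\ \ge\ c\sqrt{\frac{\kappa_\star\,(\lambda_\star\wedge\log n)}{n}},$$ where the infimum is over all estimators, i.e. all functions $(\hat{\mathbf U},\hat{\boldsymbol\Lambda})$ of $\mathbf A$ with $\hat{\mathbf U}\in\mathcal S_d(\mathbb R^n)$ and $\hat{\boldsymbol\Lambda}$ diagonal with positive diagonal entries. -/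

import Mathlib

open Filter Asymptotics
open scoped ENNReal Matrix

noncomputable section

namespace LowRankNetwork

/-- The signature matrix `I_{p,q} = diag(1, …, 1, -1, …, -1)`
(`p` entries `1` followed by `q` entries `-1`). -/
def Ipq (p q : ℕ) : Matrix (Fin (p + q)) (Fin (p + q)) ℝ :=
  Matrix.diagonal fun i => if (i : ℕ) < p then 1 else -1

/-- The indefinite orthogonal group `O_{p,q} = {Q : Q I_{p,q} Qᵀ = I_{p,q}}`. -/
def indefOrthogonal (p q : ℕ) : Set (Matrix (Fin (p + q)) (Fin (p + q)) ℝ) :=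
  {Q | Q * Ipq p q * Qᵀ = Ipq p q}

theorem Ipq_mul_self (p q : ℕ) : Ipq p q * Ipq p q = 1 := by
  unfold Ipq
  rw [Matrix.diagonal_mul_diagonal, ← Matrix.diagonal_one]
  congr 1
  funext i
  split_ifs <;> norm_num

theorem Ipq_transpose (p q : ℕ) : (Ipq p q)ᵀ = Ipq p q := by
  simp [Ipq]

theorem one_mem_indefOrthogonal (p q : ℕ) : 1 ∈ indefOrthogonal p q := by
  simp [indefOrthogonal]

theorem mul_mem_indefOrthogonal {p q : ℕ} {Q R : Matrix (Fin (p + q)) (Fin (p + q)) ℝ}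
    (hQ : Q ∈ indefOrthogonal p q) (hR : R ∈ indefOrthogonal p q) :
    Q * R ∈ indefOrthogonal p q := by
  simp only [indefOrthogonal, Set.mem_ofPred_eq] at *
  calc Q * R * Ipq p q * (Q * R)ᵀ = Q * (R * Ipq p q * Rᵀ) * Qᵀ := by
        rw [Matrix.transpose_mul]; simp only [Matrix.mul_assoc]
    _ = Ipq p q := by rw [hR, hQ]

theorem exists_inv_mem_indefOrthogonal {p q : ℕ} {Q : Matrix (Fin (p + q)) (Fin (p + q)) ℝ}
    (hQ : Q ∈ indefOrthogonal p q) : ∃ R ∈ indefOrthogonal p q, Q * R = 1 := by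
  simp only [indefOrthogonal, Set.mem_ofPred_eq] at *
  have h1 : Q * (Ipq p q * Qᵀ * Ipq p q) = 1 := by
    rw [← Matrix.mul_assoc, ← Matrix.mul_assoc, hQ, Ipq_mul_self]
  have h2 : (Ipq p q * Qᵀ * Ipq p q) * Q = 1 := mul_eq_one_comm.mp h1
  refine ⟨Ipq p q * Qᵀ * Ipq p q, ?_, h1⟩
  simp only [Matrix.transpose_mul, Matrix.transpose_transpose, Ipq_transpose]
  calc Ipq p q * Qᵀ * Ipq p q * Ipq p q * (Ipq p q * (Q * Ipq p q))
      = Ipq p q * Qᵀ * Ipq p q * (Ipq p q * Ipq p q) * Q * Ipq p q := by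
        simp only [Matrix.mul_assoc]
    _ = Ipq p q := by rw [Ipq_mul_self, Matrix.mul_one, h2, Matrix.one_mul]

/-- The equivalence relation `X ∼ Y` iff `Y = X Q` for some `Q ∈ O_{p,q}`. -/
def latentSetoid (n p q : ℕ) : Setoid (Matrix (Fin n) (Fin (p + q)) ℝ) where
  r X Y := ∃ Q ∈ indefOrthogonal p q, Y = X * Q
  iseqv :=
    { refl := fun X => ⟨1, one_mem_indefOrthogonal p q, by simp⟩
      symm := by
        rintro X Y ⟨Q, hQ, rfl⟩
        obtain ⟨R, hR, h⟩ := exists_inv_mem_indefOrthogonal hQ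
        exact ⟨R, hR, by rw [Matrix.mul_assoc, h, Matrix.mul_one]⟩
      trans := by
        rintro X Y Z ⟨Q, hQ, rfl⟩ ⟨R, hR, rfl⟩
        exact ⟨Q * R, mul_mem_indefOrthogonal hQ hR, by rw [Matrix.mul_assoc]⟩ }

/-- Equivalence classes of `n × d` matrices of latent positions, `d = p + q`. -/
abbrev LatentClass (n p q : ℕ) : Type := Quotient (latentSetoid n p q)

/-- The class `[X]`. -/
def latentClass {n p q : ℕ} (X : Matrix (Fin n) (Fin (p + q)) ℝ) : LatentClass n p q :=
  Quotient.mk (latentSetoid n p q) X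

/-- The edge probability matrix `P_X = X I_{p,q} Xᵀ`. -/
def probMatrix {n p q : ℕ} (X : Matrix (Fin n) (Fin (p + q)) ℝ) : Matrix (Fin n) (Fin n) ℝ :=
  X * Ipq p q * Xᵀ

/-- The set `𝒳_n^{(p,q)}` of latent position matrices `X` such that every entry of
`X I_{p,q} Xᵀ` lies in `[0, 1]`. -/
def latentPositions (n p q : ℕ) : Set (Matrix (Fin n) (Fin (p + q)) ℝ) :=
  {X | ∀ i j, 0 ≤ probMatrix X i j ∧ probMatrix X i j ≤ 1}

/-- The Stiefel manifold of `d`-frames in `ℝⁿ`. -/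
def stiefel (n d : ℕ) : Set (Matrix (Fin n) (Fin d) ℝ) := {U | Uᵀ * U = 1}

/-- The matrix `U Λ^{1/2}` for `Λ = diag(lam)`. -/
def scaled {n d : ℕ} (U : Matrix (Fin n) (Fin d) ℝ) (lam : Fin d → ℝ) :
    Matrix (Fin n) (Fin d) ℝ :=
  U * Matrix.diagonal fun i => Real.sqrt (lam i)

/-- The norm `‖A‖_{2,∞}`: the largest Euclidean norm of a row. -/
def twoInftyNorm {n d : ℕ} (A : Matrix (Fin n) (Fin d) ℝ) : ℝ :=
  ⨆ i, Real.sqrt (∑ k, A i k ^ 2)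

/-- `(U, Λ)` is a spectral representative of the class `x`: `U` has orthonormal columns, `Λ` is
diagonal with positive diagonal, and `U Λ^{1/2}` belongs to `x`. -/
def IsSpectralRep {n p q : ℕ} (x : LatentClass n p q)
    (U : Matrix (Fin n) (Fin (p + q)) ℝ) (lam : Fin (p + q) → ℝ) : Prop :=
  U ∈ stiefel n (p + q) ∧ (∀ i, 0 < lam i) ∧ latentClass (scaled U lam) = x

/-- The distance between classes,
`min { ‖U_X Λ_X^{1/2} - U_Y Λ_Y^{1/2} W‖_{2,∞} : W ∈ O_d ∩ O_{p,q} }`, where `(U_X, Λ_X)` and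
`(U_Y, Λ_Y)` are spectral representatives of the two classes. Two representatives of one class
differ by right multiplication of `U Λ^{1/2}` by an element of `O_d ∩ O_{p,q}`, so the minimum is
the same for every choice of representatives, and letting them range over all choices does not
change it. -/
def dTilde {n p q : ℕ} (x y : LatentClass n p q) : ℝ :=
  sInf {r | ∃ U lam V mu W, IsSpectralRep x U lam ∧ IsSpectralRep y V mu ∧
    W ∈ Matrix.orthogonalGroup (Fin (p + q)) ℝ ∧ W ∈ indefOrthogonal p q ∧
    r = twoInftyNorm (scaled U lam - scaled V mu * W)}

/-- The set `𝒞(κ⋆, λ⋆)` of (diagonals of) matrices `Λ = diag(λ_1 ≥ … ≥ λ_d)` with smallest entry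
at least `λ⋆ > 0` and condition number `λ_1 / λ_d` (the largest ratio of two entries) at most
`κ⋆`. -/
def condSet (d : ℕ) (kappaStar lamStar : ℝ) : Set (Fin d → ℝ) :=
  {lam | Antitone lam ∧ 0 < lamStar ∧ (∀ i, lamStar ≤ lam i) ∧
    ∀ i j, lam i / lam j ≤ kappaStar}

/-- The parameter set `𝒫(κ⋆, λ⋆, p, q)`. -/
def paramSet (n p q : ℕ) (kappaStar lamStar : ℝ) :
    Set (Matrix (Fin n) (Fin (p + q)) ℝ × (Fin (p + q) → ℝ)) :=
  {θ | θ.1 ∈ stiefel n (p + q) ∧ θ.2 ∈ condSet (p + q) kappaStar lamStar ∧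
    scaled θ.1 θ.2 ∈ latentPositions n p q}

/-- Pairs of indices `i < j`. -/
abbrev Pairs (n : ℕ) : Type := {e : Fin n × Fin n // e.1 < e.2}

/-- The symmetric binary adjacency matrix with zero diagonal whose entries above the diagonal are
given by `a`. -/
def adjacency {n : ℕ} (a : Pairs n → Bool) : Matrix (Fin n) (Fin n) Bool :=
  fun i j =>
    if h : i < j then a ⟨(i, j), h⟩
    else if h : j < i then a ⟨(j, i), h⟩
    else false

/-- The probability of the entries `a` above the diagonal when `A_ij ∼ Bern(P_ij)` independently
over `i < j`. -/
def networkProb {n : ℕ} (P : Matrix (Fin n) (Fin n) ℝ) (a : Pairs n → Bool) : ℝ :=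
  ∏ e : Pairs n, if a e then P e.1.1 e.1.2 else 1 - P e.1.1 e.1.2

/-- The expectation `𝔼 f(A)` when `A` is the adjacency matrix of the network model with edge
probability matrix `P`. -/
def networkExp {n : ℕ} (P : Matrix (Fin n) (Fin n) ℝ)
    (f : Matrix (Fin n) (Fin n) Bool → ℝ) : ℝ :=
  ∑ a : Pairs n → Bool, networkProb P a * f (adjacency a)

/-- The values an estimator may take: a frame `U` and a diagonal matrix `Λ` with positive diagonal,
without any further restriction. -/
structure SpectralPair (n d : ℕ) where
  /-- The frame `U`. -/
  U : Matrix (Fin n) (Fin d) ℝ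
  /-- The diagonal of `Λ`. -/
  lam : Fin d → ℝ
  frame : U ∈ stiefel n d
  pos : ∀ i, 0 < lam i

/-- Estimators `(Û, Λ̂)`: arbitrary functions of the observed adjacency matrix. -/
abbrev Estimator (n d : ℕ) : Type := Matrix (Fin n) (Fin n) Bool → SpectralPair n d

/-- The risk of an estimator at the parameter `θ = (U, Λ)`: the expected distance between
`[Û Λ̂^{1/2}]` and `[U Λ^{1/2}]`. -/
def risk {n p q : ℕ} (est : Estimator n (p + q))
    (θ : Matrix (Fin n) (Fin (p + q)) ℝ × (Fin (p + q) → ℝ)) : ℝ :=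
  networkExp (probMatrix (scaled θ.1 θ.2)) fun A =>
    dTilde (latentClass (scaled (est A).U (est A).lam)) (latentClass (scaled θ.1 θ.2))

/-- The minimax risk over `𝒫(κ⋆, λ⋆, p, q)`, as an extended nonnegative real number. -/
def minimaxRisk (n p q : ℕ) (kappaStar lamStar : ℝ) : ℝ≥0∞ :=
  ⨅ est : Estimator n (p + q), ⨆ θ ∈ paramSet n p q kappaStar lamStar,
    ENNReal.ofReal (risk est θ)

end LowRankNetwork

end

namespace LowRankNetwork

/-! ### Spectral representatives and distances between rows -/

/-! The bound comes from a many-hypotheses testing argument in which the hypotheses differ by a bump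
at a single row. Write `ℓ` for `λ⋆`, `κ` for `κ⋆` and `s = min ℓ (log n)`. For `d ≥ 2` take
eigenvalues `κℓ, ℓ, …, ℓ`. The leading eigenvector is constant, so every edge probability has order
`κℓ/n`, and the other columns alternate in sign on disjoint blocks of rows. A positive fraction of
the rows lies outside all blocks. For each such row `a`, one column with eigenvalue `ℓ` is changed
by `η(e_a - e_b)` with `b` fixed. This changes the probability matrix by `O(ℓη)` in Frobenius norm,
so the chi-square cost is `O(exp(C ℓ²η²/(κℓ/n)))`. With order `n` hypotheses a cost up to a small
multiple of `n` is allowed, hence `η² ≍ κs/(ℓn)`, and the separation `η√ℓ` has order `√(κs/n)`.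

The alignment over `W` is avoided through distances between two rows: they are invariants of the
class, and `abs_rowDist_sub_rowDist_le_dTilde` bounds their change by twice the loss.
`le_minimaxRisk_of_separated` turns separation and chi-square control into a risk bound, and
`le_minimaxRisk_of_bumpFrame` specialises it to bumps. For `d = 1` there is no second column, so the
constant column itself is perturbed; the resulting rate lacks `κ`, which is harmless when `κ` is
bounded. -/

theorem scaled_apply {n d : ℕ} (U : Matrix (Fin n) (Fin d) ℝ) (lam : Fin d → ℝ) (i : Fin n)
    (k : Fin d) : scaled U lam i k = U i k * Real.sqrt (lam k) := by
  simp [scaled, Matrix.mul_diagonal]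

theorem probMatrix_scaled_apply {n p q : ℕ} (U : Matrix (Fin n) (Fin (p + q)) ℝ)
    {lam : Fin (p + q) → ℝ} (hlam : ∀ k, 0 ≤ lam k) (i j : Fin n) :
    probMatrix (scaled U lam) i j =
      ∑ k : Fin (p + q), (if (k : ℕ) < p then 1 else -1) * (lam k * (U i k * U j k)) := by
  simp only [probMatrix, Ipq, Matrix.mul_apply (N := (scaled U lam)ᵀ), Matrix.mul_diagonal,
    Matrix.transpose_apply, scaled_apply]
  refine Finset.sum_congr rfl fun k _ => ?_
  have h := Real.mul_self_sqrt (hlam k)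
  linear_combination (U i k * U j k * (if (k : ℕ) < p then 1 else -1)) * h

theorem scaled_transpose_mul_self {n d : ℕ} {U : Matrix (Fin n) (Fin d) ℝ} (hU : U ∈ stiefel n d)
    {lam : Fin d → ℝ} (hlam : ∀ k, 0 ≤ lam k) :
    (scaled U lam)ᵀ * scaled U lam = Matrix.diagonal lam := by
  have h : Uᵀ * U = 1 := hU
  simp only [scaled, Matrix.transpose_mul, Matrix.diagonal_transpose]
  rw [Matrix.mul_assoc, ← Matrix.mul_assoc Uᵀ, h, Matrix.one_mul, Matrix.diagonal_mul_diagonal]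
  congr 1
  funext k
  exact Real.mul_self_sqrt (hlam k)

/-- An element of `O_{p,q}` that conjugates one positive diagonal form into another is
orthogonal. -/
theorem mul_transpose_eq_one_of_diagonal {p q : ℕ} {Q : Matrix (Fin (p + q)) (Fin (p + q)) ℝ}
    (hQ : Q ∈ indefOrthogonal p q) {lam mu : Fin (p + q) → ℝ} (hlam : ∀ k, 0 < lam k)
    (hmu : ∀ k, 0 < mu k) (h : Qᵀ * Matrix.diagonal lam * Q = Matrix.diagonal mu) :
    Q * Qᵀ = 1 := by
  have hQ' : Q * Ipq p q * Qᵀ = Ipq p q := hQ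
  have hI := Ipq_mul_self p q
  have key : Ipq p q * Matrix.diagonal lam * Q = Q * Ipq p q * Matrix.diagonal mu := by
    rw [← h]
    calc Ipq p q * Matrix.diagonal lam * Q
        = (Q * Ipq p q * Qᵀ) * Matrix.diagonal lam * Q := by rw [hQ']
      _ = _ := by simp only [Matrix.mul_assoc]
  -- Entrywise, `key` reads `ε_i λ_i Q_ij = Q_ij ε_j μ_j`. Opposite signs give `(λ_i + μ_j) Q_ij =
  -- 0`, so positivity makes `Q` block diagonal.
  have comm : Ipq p q * Q = Q * Ipq p q := by
    ext i j
    have hk := congrFun (congrFun key i) j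
    simp only [Ipq, Matrix.diagonal_mul_diagonal, Matrix.diagonal_mul, Matrix.mul_diagonal]
      at hk ⊢
    have h1 := hlam i
    have h2 := hmu j
    have h3 : 0 < lam i + mu j := by positivity
    by_cases hi : (i : ℕ) < p <;> by_cases hj : (j : ℕ) < p <;> simp only [hi, hj, if_true,
      if_false] at hk ⊢
    · ring
    · have : Q i j * (lam i + mu j) = 0 := by linarith
      have : Q i j = 0 := by simpa [h3.ne'] using this
      simp [this]
    · have : Q i j * (lam i + mu j) = 0 := by linarith
      have : Q i j = 0 := by simpa [h3.ne'] using this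
      simp [this]
    · ring
  calc Q * Qᵀ = Ipq p q * (Ipq p q * Q) * Qᵀ := by
        rw [← Matrix.mul_assoc (Ipq p q), hI, Matrix.one_mul]
    _ = Ipq p q * (Q * Ipq p q * Qᵀ) := by rw [comm]; simp only [Matrix.mul_assoc]
    _ = 1 := by rw [hQ', hI]

/-- The Euclidean distance between two rows of a matrix. -/
noncomputable def rowDist {n d : ℕ} (X : Matrix (Fin n) (Fin d) ℝ) (i j : Fin n) : ℝ :=
  ‖WithLp.toLp 2 (X i - X j)‖

theorem rowDist_eq_sqrt {n d : ℕ} (X : Matrix (Fin n) (Fin d) ℝ) (i j : Fin n) :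
    rowDist X i j = Real.sqrt (∑ k, (X i k - X j k) ^ 2) := by
  simp [rowDist, EuclideanSpace.norm_eq]

theorem rowDist_mul_of_orthogonal {n d : ℕ} (X : Matrix (Fin n) (Fin d) ℝ)
    {Q : Matrix (Fin d) (Fin d) ℝ} (hQ : Q * Qᵀ = 1) (i j : Fin n) :
    rowDist (X * Q) i j = rowDist X i j := by
  have hrow : ∀ k, (X * Q) i k - (X * Q) j k = ((X i - X j) ᵥ* Q) k := by
    intro k
    simp [Matrix.mul_apply, Matrix.vecMul, dotProduct, sub_mul, Finset.sum_sub_distrib]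
  rw [rowDist_eq_sqrt, rowDist_eq_sqrt]
  congr 1
  have h : ((X i - X j) ᵥ* Q) ⬝ᵥ ((X i - X j) ᵥ* Q) = (X i - X j) ⬝ᵥ (X i - X j) := by
    rw [← Matrix.dotProduct_mulVec, ← Matrix.vecMul_transpose, Matrix.vecMul_vecMul, hQ,
      Matrix.vecMul_one]
  simp only [hrow]
  simpa [dotProduct, sq] using h

theorem norm_row_le_twoInftyNorm {n d : ℕ} (A : Matrix (Fin n) (Fin d) ℝ) (i : Fin n) :
    ‖WithLp.toLp 2 (A i)‖ ≤ twoInftyNorm A := by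
  have h : ‖WithLp.toLp 2 (A i)‖ = Real.sqrt (∑ k, A i k ^ 2) := by
    simp [EuclideanSpace.norm_eq]
  rw [h]
  exact le_ciSup (f := fun i => Real.sqrt (∑ k, A i k ^ 2)) (Set.finite_range _).bddAbove i

theorem abs_rowDist_sub_rowDist_le {n d : ℕ} (X Y : Matrix (Fin n) (Fin d) ℝ) (i j : Fin n) :
    |rowDist X i j - rowDist Y i j| ≤ 2 * twoInftyNorm (X - Y) := by
  have h1 := norm_row_le_twoInftyNorm (X - Y) i
  have h2 := norm_row_le_twoInftyNorm (X - Y) j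
  calc |rowDist X i j - rowDist Y i j|
      ≤ ‖WithLp.toLp 2 (X i - X j) - WithLp.toLp 2 (Y i - Y j)‖ := abs_norm_sub_norm_le _ _
    _ = ‖WithLp.toLp 2 ((X - Y) i) - WithLp.toLp 2 ((X - Y) j)‖ := by
        congr 1
        ext k
        simp
        ring
    _ ≤ _ := (norm_sub_le _ _).trans (by linarith)

/-- The Gram matrices of both representatives are diagonal, so the element of `O_{p,q}` relating
them is orthogonal and preserves Euclidean distances between rows. -/
theorem rowDist_eq_of_isSpectralRep {n p q : ℕ} {x : LatentClass n p q}
    {U V : Matrix (Fin n) (Fin (p + q)) ℝ} {lam mu : Fin (p + q) → ℝ}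
    (hU : IsSpectralRep x U lam) (hV : IsSpectralRep x V mu) (i j : Fin n) :
    rowDist (scaled U lam) i j = rowDist (scaled V mu) i j := by
  obtain ⟨hU1, hlam, hU2⟩ := hU
  obtain ⟨hV1, hmu, hV2⟩ := hV
  obtain ⟨Q, hQ, h⟩ : ∃ Q ∈ indefOrthogonal p q, scaled V mu = scaled U lam * Q :=
    Quotient.exact (hU2.trans hV2.symm)
  have h1 := scaled_transpose_mul_self hV1 fun k => (hmu k).le
  rw [h, Matrix.transpose_mul, Matrix.mul_assoc, ← Matrix.mul_assoc (scaled U lam)ᵀ,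
    scaled_transpose_mul_self hU1 fun k => (hlam k).le, ← Matrix.mul_assoc] at h1
  rw [h, rowDist_mul_of_orthogonal _ (mul_transpose_eq_one_of_diagonal hQ hlam hmu h1)]

/-- Neither the choice of representatives nor an orthogonal `W` affects row distances, so the
triangle inequality at the two rows applies to every competitor in the infimum. -/
theorem abs_rowDist_sub_rowDist_le_dTilde {n p q : ℕ} {x y : LatentClass n p q}
    {U V : Matrix (Fin n) (Fin (p + q)) ℝ} {lam mu : Fin (p + q) → ℝ}
    (hU : IsSpectralRep x U lam) (hV : IsSpectralRep y V mu) (i j : Fin n) :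
    |rowDist (scaled U lam) i j - rowDist (scaled V mu) i j| ≤ 2 * dTilde x y := by
  have : |rowDist (scaled U lam) i j - rowDist (scaled V mu) i j| / 2 ≤ dTilde x y := by
    refine le_csInf ⟨_, U, lam, V, mu, 1, hU, hV, one_mem _, one_mem_indefOrthogonal p q, rfl⟩ ?_
    rintro r ⟨U', lam', V', mu', W, hU', hV', hW, -, rfl⟩
    have hW' : W * Wᵀ = 1 := (Matrix.mem_orthogonalGroup_iff _ _).1 hW
    rw [rowDist_eq_of_isSpectralRep hU hU', rowDist_eq_of_isSpectralRep hV hV',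
      ← rowDist_mul_of_orthogonal (scaled V' mu') hW']
    linarith [abs_rowDist_sub_rowDist_le (scaled U' lam') (scaled V' mu' * W) i j]
  linarith

theorem twoInftyNorm_nonneg {n d : ℕ} (A : Matrix (Fin n) (Fin d) ℝ) : 0 ≤ twoInftyNorm A :=
  Real.iSup_nonneg fun _ => Real.sqrt_nonneg _

theorem dTilde_nonneg {n p q : ℕ} (x y : LatentClass n p q) : 0 ≤ dTilde x y := by
  refine Real.sInf_nonneg ?_
  rintro r ⟨U, lam, V, mu, W, -, -, -, -, rfl⟩
  exact twoInftyNorm_nonneg _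

/-! ### Network likelihoods -/

theorem networkProb_nonneg {n : ℕ} {P : Matrix (Fin n) (Fin n) ℝ}
    (hP : ∀ i j, 0 ≤ P i j ∧ P i j ≤ 1) (a : Pairs n → Bool) : 0 ≤ networkProb P a := by
  refine Finset.prod_nonneg fun e _ => ?_
  have := hP e.1.1 e.1.2
  split_ifs <;> linarith

theorem networkProb_pos {n : ℕ} {P : Matrix (Fin n) (Fin n) ℝ}
    (hP : ∀ i j, 0 < P i j ∧ P i j < 1) (a : Pairs n → Bool) : 0 < networkProb P a := by
  refine Finset.prod_pos fun e _ => ?_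
  have := hP e.1.1 e.1.2
  split_ifs <;> linarith

theorem sum_prod_bool {ι : Type*} [Fintype ι] [DecidableEq ι] (f g : ι → ℝ) :
    ∑ a : ι → Bool, ∏ e, (if a e then f e else g e) = ∏ e, (f e + g e) := by
  have h := Finset.prod_univ_sum (fun _ : ι => (Finset.univ : Finset Bool))
    (fun e b => if b then f e else g e)
  rw [Fintype.piFinset_univ] at h
  simpa using h.symm

theorem sum_networkProb {n : ℕ} (P : Matrix (Fin n) (Fin n) ℝ) :
    ∑ a, networkProb P a = 1 := by
  simp only [networkProb]
  rw [sum_prod_bool (fun e : Pairs n => P e.1.1 e.1.2) (fun e => 1 - P e.1.1 e.1.2)]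
  simp

/-- The second moment of the likelihood ratio factorises over edges. The factor of an edge is `1 +
(x - y)²/(y(1 - y))`, and `L ≤ y ≤ 1/2` gives `y(1 - y) ≥ L/2`. -/
theorem sum_networkProb_sq_div_le {n : ℕ} {P P₀ : Matrix (Fin n) (Fin n) ℝ} {L : ℝ} (hL : 0 < L)
    (hP : ∀ i j, L ≤ P₀ i j ∧ P₀ i j ≤ 1 / 2) :
    ∑ a, networkProb P a ^ 2 / networkProb P₀ a
      ≤ Real.exp (2 / L * ∑ i, ∑ j, (P i j - P₀ i j) ^ 2) := by
  have h1 : ∑ a, networkProb P a ^ 2 / networkProb P₀ a = ∏ e : Pairs n,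
      (P e.1.1 e.1.2 ^ 2 / P₀ e.1.1 e.1.2 + (1 - P e.1.1 e.1.2) ^ 2 / (1 - P₀ e.1.1 e.1.2)) := by
    rw [← sum_prod_bool]
    refine Finset.sum_congr rfl fun a _ => ?_
    simp only [networkProb, ← Finset.prod_pow, ← Finset.prod_div_distrib]
    refine Finset.prod_congr rfl fun e _ => ?_
    split_ifs <;> rfl
  have h2 : ∀ e : Pairs n, P e.1.1 e.1.2 ^ 2 / P₀ e.1.1 e.1.2 +
      (1 - P e.1.1 e.1.2) ^ 2 / (1 - P₀ e.1.1 e.1.2)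
        ≤ Real.exp (2 / L * (P e.1.1 e.1.2 - P₀ e.1.1 e.1.2) ^ 2) := by
    intro e
    obtain ⟨hl, hu⟩ := hP e.1.1 e.1.2
    set x := P e.1.1 e.1.2
    set y := P₀ e.1.1 e.1.2
    have hy : 0 < y := by linarith
    have hy' : 0 < 1 - y := by linarith
    have heq : x ^ 2 / y + (1 - x) ^ 2 / (1 - y) = 1 + (x - y) ^ 2 / (y * (1 - y)) := by
      field_simp
      ring
    have hden : L / 2 ≤ y * (1 - y) := by nlinarith
    have hle : (x - y) ^ 2 / (y * (1 - y)) ≤ 2 / L * (x - y) ^ 2 := by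
      calc (x - y) ^ 2 / (y * (1 - y)) ≤ (x - y) ^ 2 / (L / 2) := by gcongr
        _ = 2 / L * (x - y) ^ 2 := by field_simp
    rw [heq]
    linarith [Real.add_one_le_exp (2 / L * (x - y) ^ 2)]
  have h3 : ∑ e : Pairs n, (P e.1.1 e.1.2 - P₀ e.1.1 e.1.2) ^ 2
      ≤ ∑ i, ∑ j, (P i j - P₀ i j) ^ 2 := by
    rw [← Fintype.sum_prod_type' (f := fun i j => (P i j - P₀ i j) ^ 2)]
    calc ∑ e : Pairs n, (P e.1.1 e.1.2 - P₀ e.1.1 e.1.2) ^ 2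
        = ∑ x ∈ Finset.univ.map (Function.Embedding.subtype fun e : Fin n × Fin n => e.1 < e.2),
          (P x.1 x.2 - P₀ x.1 x.2) ^ 2 := by rw [Finset.sum_map]; rfl
      _ ≤ _ := Finset.sum_le_univ_sum_of_nonneg fun _ => sq_nonneg _
  rw [h1]
  calc _ ≤ ∏ e : Pairs n, Real.exp (2 / L * (P e.1.1 e.1.2 - P₀ e.1.1 e.1.2) ^ 2) := by
        refine Finset.prod_le_prod (fun e _ => ?_) fun e _ => h2 e
        obtain ⟨hl, hu⟩ := hP e.1.1 e.1.2
        have hy : 0 < P₀ e.1.1 e.1.2 := by linarith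
        have hy' : 0 < 1 - P₀ e.1.1 e.1.2 := by linarith
        positivity
    _ = Real.exp (2 / L * ∑ e : Pairs n, (P e.1.1 e.1.2 - P₀ e.1.1 e.1.2) ^ 2) := by
        rw [← Real.exp_sum, Finset.mul_sum]
    _ ≤ _ := by gcongr

/-- Disjoint acceptance regions have small average probability under hypotheses that are close in
chi-square divergence to a common reference measure. -/
theorem sum_sum_le_of_sum_sq_div_le {Ω ι : Type*} [Fintype Ω] (T : Finset ι)
    {P : ι → Ω → ℝ} {P₀ : Ω → ℝ} (hP₀ : ∀ ω, 0 < P₀ ω) (hsum : ∑ ω, P₀ ω = 1)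
    (hchi : ∀ t ∈ T, ∑ ω, P t ω ^ 2 / P₀ ω ≤ (T.card : ℝ) / 4) (B : ι → Finset Ω)
    (hB : ∀ s ∈ T, ∀ t ∈ T, s ≠ t → Disjoint (B s) (B t)) :
    ∑ t ∈ T, ∑ ω ∈ B t, P t ω ≤ (T.card : ℝ) / 2 := by
  classical
  -- Cauchy–Schwarz weighted by `P₀`: by disjointness the first factor is at most `1`, and the
  -- second is at most `|T|²/4`.
  have h1 : (∑ t ∈ T, ∑ ω ∈ B t, P t ω) ^ 2
      ≤ (∑ t ∈ T, ∑ ω ∈ B t, P₀ ω) * ∑ t ∈ T, ∑ ω ∈ B t, P t ω ^ 2 / P₀ ω := by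
    simp only [Finset.sum_sigma']
    refine Finset.sum_sq_le_sum_mul_sum_of_sq_le_mul _ (fun x _ => (hP₀ x.2).le)
      (fun x _ => div_nonneg (sq_nonneg _) (hP₀ x.2).le) fun x _ => ?_
    have := (hP₀ x.2).ne'
    exact le_of_eq (by field_simp)
  have h2 : ∑ t ∈ T, ∑ ω ∈ B t, P₀ ω ≤ 1 := by
    rw [← Finset.sum_biUnion fun s hs t ht hst => hB s hs t ht hst, ← hsum]
    exact Finset.sum_le_univ_sum_of_nonneg fun ω => (hP₀ ω).le
  have hnn : ∀ t ω, 0 ≤ P t ω ^ 2 / P₀ ω := fun t ω => div_nonneg (sq_nonneg _) (hP₀ ω).le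
  have h3 : ∑ t ∈ T, ∑ ω ∈ B t, P t ω ^ 2 / P₀ ω ≤ T.card * ((T.card : ℝ) / 4) := by
    rw [← nsmul_eq_mul]
    exact Finset.sum_le_card_nsmul _ _ _ fun t ht =>
      (Finset.sum_le_univ_sum_of_nonneg (hnn t)).trans (hchi t ht)
  have h4 : 0 ≤ ∑ t ∈ T, ∑ ω ∈ B t, P t ω ^ 2 / P₀ ω :=
    Finset.sum_nonneg fun t _ => Finset.sum_nonneg fun ω _ => hnn t ω
  refine abs_le_of_sq_le_sq' ?_ (by positivity) |>.2
  nlinarith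

/-- Lower bound on the minimax risk from finitely many parameters that are separated by the
distance between two rows. -/
theorem le_minimaxRisk_of_separated {n p q : ℕ} {kappaStar lamStar : ℝ} {ι : Type*}
    {T : Finset ι} (hT : T.Nonempty)
    {U : ι → Matrix (Fin n) (Fin (p + q)) ℝ} {lam : Fin (p + q) → ℝ}
    (hU : ∀ t ∈ T, (U t, lam) ∈ paramSet n p q kappaStar lamStar)
    {P₀ : Matrix (Fin n) (Fin n) ℝ} (hP₀ : ∀ i j, 0 < P₀ i j ∧ P₀ i j < 1)
    (hchi : ∀ t ∈ T, ∑ a, networkProb (probMatrix (scaled (U t) lam)) a ^ 2 / networkProb P₀ a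
      ≤ (T.card : ℝ) / 4)
    {δ : ℝ} (hδ : 0 ≤ δ) (i : ι → Fin n) (r : Fin n)
    (hsep : ∀ t ∈ T, rowDist (scaled (U t) lam) (i t) r = δ)
    (hzero : ∀ s ∈ T, ∀ t ∈ T, s ≠ t → rowDist (scaled (U s) lam) (i t) r = 0) :
    ENNReal.ofReal (δ / 8) ≤ minimaxRisk n p q kappaStar lamStar := by
  classical
  refine le_iInf fun est => ?_
  have hrep : ∀ t ∈ T, IsSpectralRep (latentClass (scaled (U t) lam)) (U t) lam := by
    intro t ht
    obtain ⟨h1, ⟨-, h2, h3, -⟩, -⟩ := hU t ht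
    exact ⟨h1, fun k => h2.trans_le (h3 k), rfl⟩
  have hest : ∀ A, IsSpectralRep (p := p) (q := q)
      (latentClass (scaled (est A).U (est A).lam)) (est A).U (est A).lam :=
    fun A => ⟨(est A).frame, (est A).pos, rfl⟩
  let D : ι → (Pairs n → Bool) → ℝ := fun t a =>
    dTilde (latentClass (p := p) (q := q)
      (scaled (est (adjacency a)).U (est (adjacency a)).lam)) (latentClass (scaled (U t) lam))
  -- A loss below `δ/4` moves a row distance by less than `δ/2`. In `B s ∩ B t` the estimate's
  -- distance between rows `i t` and `r` would be both below and above `δ/2`.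
  let B : ι → Finset (Pairs n → Bool) := fun t => Finset.univ.filter fun a => D t a < δ / 4
  have hB : ∀ s ∈ T, ∀ t ∈ T, s ≠ t → Disjoint (B s) (B t) := by
    intro s hs t ht hst
    rw [Finset.disjoint_left]
    intro a has hat
    have has' : D s a < δ / 4 := (Finset.mem_filter.1 has).2
    have hat' : D t a < δ / 4 := (Finset.mem_filter.1 hat).2
    have h1 := abs_rowDist_sub_rowDist_le_dTilde (hest (adjacency a)) (hrep s hs) (i t) r
    have h2 := abs_rowDist_sub_rowDist_le_dTilde (hest (adjacency a)) (hrep t ht) (i t) r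
    rw [hzero s hs t ht hst] at h1
    rw [hsep t ht] at h2
    have h3 := (abs_le.1 h1).2
    have h4 := (abs_le.1 h2).1
    change _ ≤ 2 * D s a at h3
    change -(2 * D t a) ≤ _ at h4
    linarith
  have hrisk : ∀ t ∈ T, δ / 4 * (1 - ∑ a ∈ B t, networkProb (probMatrix (scaled (U t) lam)) a)
      ≤ risk est (U t, lam) := by
    intro t ht
    have hnn := networkProb_nonneg (hU t ht).2.2
    rw [← sum_networkProb (probMatrix (scaled (U t) lam)),
      ← Finset.sum_compl_add_sum (B t), add_sub_cancel_right, Finset.mul_sum]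
    calc ∑ a ∈ (B t)ᶜ, δ / 4 * networkProb (probMatrix (scaled (U t) lam)) a
        ≤ ∑ a ∈ (B t)ᶜ, networkProb (probMatrix (scaled (U t) lam)) a * D t a := by
          refine Finset.sum_le_sum fun a ha => ?_
          have : δ / 4 ≤ D t a := by
            simpa [B] using ha
          rw [mul_comm]
          exact mul_le_mul_of_nonneg_left this (hnn a)
      _ ≤ ∑ a, networkProb (probMatrix (scaled (U t) lam)) a * D t a :=
          Finset.sum_le_univ_sum_of_nonneg fun a => mul_nonneg (hnn a) (dTilde_nonneg _ _)
      _ = _ := rfl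
  -- On average at least half of the mass lies outside the acceptance regions, where the loss is at
  -- least `δ/4`.
  have havg : ∑ t ∈ T, δ / 8 ≤ ∑ t ∈ T, risk est (U t, lam) := by
    have h := sum_sum_le_of_sum_sq_div_le T (networkProb_pos hP₀) (sum_networkProb P₀) hchi B hB
    refine le_trans ?_ (Finset.sum_le_sum hrisk)
    rw [← Finset.mul_sum, Finset.sum_sub_distrib, Finset.sum_const, Finset.sum_const,
      nsmul_eq_mul, nsmul_eq_mul]
    nlinarith
  obtain ⟨t, ht, hle⟩ := Finset.exists_le_of_sum_le hT havg
  exact (ENNReal.ofReal_le_ofReal hle).trans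
    (le_iSup₂ (f := fun θ (_ : θ ∈ paramSet n p q kappaStar lamStar) =>
      ENNReal.ofReal (risk est θ)) (U t, lam) (hU t ht))

/-! ### Perturbing two entries of one column of a frame -/

/-- Replace the column `u` with index `k₀` by `α u + η (e_a - e_b)`. -/
def bumpFrame {n d : ℕ} (U : Matrix (Fin n) (Fin d) ℝ) (k₀ : Fin d) (a b : Fin n) (α η : ℝ) :
    Matrix (Fin n) (Fin d) ℝ :=
  fun i k => if k = k₀ then
    α * U i k + η * ((if i = a then 1 else 0) - (if i = b then 1 else 0)) else U i k

theorem mem_stiefel_iff {n d : ℕ} {U : Matrix (Fin n) (Fin d) ℝ} :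
    U ∈ stiefel n d ↔ ∀ k l, ∑ i, U i k * U i l = if k = l then 1 else 0 := by
  simp only [stiefel, Set.mem_ofPred_eq, ← Matrix.ext_iff, Matrix.mul_apply,
    Matrix.transpose_apply, Matrix.one_apply]

theorem sum_bump_mul {n : ℕ} (u f : Fin n → ℝ) (a b : Fin n) (α η : ℝ) :
    ∑ i, (α * u i + η * ((if i = a then 1 else 0) - (if i = b then 1 else 0))) * f i
      = α * ∑ i, u i * f i + η * (f a - f b) := by
  simp only [add_mul, mul_assoc, sub_mul, mul_sub, Finset.sum_add_distrib, Finset.sum_sub_distrib,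
    ← Finset.mul_sum, ite_mul, one_mul, zero_mul, Finset.sum_ite_eq', Finset.mem_univ, if_true]

/-- Equality of rows `a` and `b` makes `e_a - e_b` orthogonal to every column of `U`; the new column
then has squared norm `α² + 2η²`. -/
theorem bumpFrame_mem_stiefel {n d : ℕ} {U : Matrix (Fin n) (Fin d) ℝ} (hU : U ∈ stiefel n d)
    (k₀ : Fin d) {a b : Fin n} (hab : a ≠ b) (hrow : ∀ k, U a k = U b k) {α η : ℝ}
    (hαη : α ^ 2 + 2 * η ^ 2 = 1) : bumpFrame U k₀ a b α η ∈ stiefel n d := by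
  rw [mem_stiefel_iff] at hU ⊢
  intro k l
  simp only [bumpFrame]
  by_cases hk : k = k₀
  · subst hk
    simp only [if_true]
    rw [sum_bump_mul (fun i => U i k)]
    by_cases hl : l = k
    · subst hl
      have h : ∑ i, U i l * (α * U i l + η * ((if i = a then 1 else 0) - (if i = b then 1 else 0)))
          = α := by
        have := sum_bump_mul (fun i => U i l) (fun i => U i l) a b α η
        rw [hU, hrow] at this
        simpa [mul_comm] using this
      simp [h, hab, hab.symm, hrow]
      linear_combination hαη
    · simp [hl, hU, hrow, Ne.symm hl]
  · by_cases hl : l = k₀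
    · subst hl
      have := sum_bump_mul (fun i => U i l) (fun i => U i k) a b α η
      rw [hU] at this
      simp only [hk, if_false, if_true]
      simpa [mul_comm, hk, Ne.symm hk, hrow] using this
    · simp [hk, hl, hU]

theorem rowDist_scaled_of_eq {n d : ℕ} {U : Matrix (Fin n) (Fin d) ℝ} (lam : Fin d → ℝ)
    {i j : Fin n} (h : ∀ k, U i k = U j k) : rowDist (scaled U lam) i j = 0 := by
  simp [rowDist_eq_sqrt, scaled_apply, h]

theorem rowDist_scaled_bumpFrame {n d : ℕ} {U : Matrix (Fin n) (Fin d) ℝ} (k₀ : Fin d)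
    (lam : Fin d → ℝ) {a b r : Fin n} (hab : a ≠ b) (har : r ≠ a)
    (hbr : r ≠ b) (hrow : ∀ k, U a k = U r k) (α : ℝ) {η : ℝ} (hη : 0 ≤ η) :
    rowDist (scaled (bumpFrame U k₀ a b α η) lam) a r = η * Real.sqrt (lam k₀) := by
  rw [rowDist_eq_sqrt, Finset.sum_eq_single k₀]
  · rw [Real.sqrt_sq_eq_abs]
    simp only [scaled_apply, bumpFrame, if_true, hab, har, hbr, if_false, hrow]
    rw [← sub_mul]
    simp [abs_of_nonneg, hη, Real.sqrt_nonneg]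
  · intro k _ hk
    simp [scaled_apply, bumpFrame, hk, hrow]
  · simp

/-- With `w = e_a - e_b` the difference is `αη(u wᵀ + w uᵀ) + η² w wᵀ`. Squaring three terms costs a
factor `3`, and `‖w‖² = 2` gives `12η²(α² + η²)`, where `α² + η² ≤ 1`. -/
theorem sum_sq_bump_outer_le {n : ℕ} {u : Fin n → ℝ} (hu : ∑ i, u i ^ 2 = 1) {a b : Fin n}
    (hab : a ≠ b) {α η : ℝ} (hαη : α ^ 2 + 2 * η ^ 2 = 1) :
    ∑ i, ∑ j, ((α * u i + η * ((if i = a then 1 else 0) - (if i = b then 1 else 0))) *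
        (α * u j + η * ((if j = a then 1 else 0) - (if j = b then 1 else 0)))
        - (α * u i) * (α * u j)) ^ 2 ≤ 12 * η ^ 2 := by
  set w : Fin n → ℝ := fun i => (if i = a then 1 else 0) - (if i = b then 1 else 0) with hw
  have hw2 : ∑ i, w i ^ 2 = 2 := by
    have h := sum_bump_mul (fun _ => 0) w a b 0 1
    simp only [zero_mul, zero_add, one_mul, Finset.sum_const_zero] at h
    calc ∑ i, w i ^ 2 = w a - w b := by simpa only [sq] using h
      _ = 2 := by simp [hw, hab, hab.symm]; norm_num
  have hle : ∀ i j, ((α * u i + η * w i) * (α * u j + η * w j) - (α * u i) * (α * u j)) ^ 2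
      ≤ 3 * η ^ 2 * α ^ 2 * (u i ^ 2 * w j ^ 2) + 3 * η ^ 2 * α ^ 2 * (w i ^ 2 * u j ^ 2)
        + 3 * η ^ 4 * (w i ^ 2 * w j ^ 2) := by
    intro i j
    nlinarith [sq_nonneg (α * η * u i * w j - α * η * w i * u j),
      sq_nonneg (α * η * u i * w j - η ^ 2 * w i * w j),
      sq_nonneg (α * η * w i * u j - η ^ 2 * w i * w j)]
  calc _ ≤ ∑ i, ∑ j, (3 * η ^ 2 * α ^ 2 * (u i ^ 2 * w j ^ 2)
          + 3 * η ^ 2 * α ^ 2 * (w i ^ 2 * u j ^ 2) + 3 * η ^ 4 * (w i ^ 2 * w j ^ 2)) :=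
        Finset.sum_le_sum fun i _ => Finset.sum_le_sum fun j _ => hle i j
    _ = 12 * η ^ 2 * (α ^ 2 + η ^ 2) := by
        simp only [Finset.sum_add_distrib, ← Finset.mul_sum, ← Finset.sum_mul, hu, hw2]
        ring
    _ ≤ 12 * η ^ 2 := by nlinarith [sq_nonneg η]

/-- The reference column is already shrunk by `α`, so only the bump remains in the difference. The
reference need not come from a frame, since it serves only as a dominating measure. Its indices
`a'`, `b'` have no effect at amplitude `0`. -/
theorem sum_sq_probMatrix_bumpFrame_sub_le {n p q : ℕ} {U : Matrix (Fin n) (Fin (p + q)) ℝ}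
    (hU : U ∈ stiefel n (p + q)) (k₀ : Fin (p + q)) {lam : Fin (p + q) → ℝ}
    (hlam : ∀ k, 0 ≤ lam k) {a b : Fin n} (hab : a ≠ b) (a' b' : Fin n) {α η : ℝ}
    (hαη : α ^ 2 + 2 * η ^ 2 = 1) :
    ∑ i, ∑ j, (probMatrix (scaled (bumpFrame U k₀ a b α η) lam) i j
      - probMatrix (scaled (bumpFrame U k₀ a' b' α 0) lam) i j) ^ 2
      ≤ 12 * lam k₀ ^ 2 * η ^ 2 := by
  have hu : ∑ i, U i k₀ ^ 2 = 1 := by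
    simpa [sq] using mem_stiefel_iff.1 hU k₀ k₀
  have h := sum_sq_bump_outer_le hu hab hαη
  have heq : ∀ i j, (probMatrix (scaled (bumpFrame U k₀ a b α η) lam) i j
      - probMatrix (scaled (bumpFrame U k₀ a' b' α 0) lam) i j) ^ 2 = lam k₀ ^ 2 *
      ((α * U i k₀ + η * ((if i = a then 1 else 0) - (if i = b then 1 else 0))) *
        (α * U j k₀ + η * ((if j = a then 1 else 0) - (if j = b then 1 else 0)))
        - (α * U i k₀) * (α * U j k₀)) ^ 2 := by
    intro i j
    rw [probMatrix_scaled_apply _ hlam, probMatrix_scaled_apply _ hlam,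
      ← Finset.sum_sub_distrib, Finset.sum_eq_single k₀]
    · simp only [bumpFrame, if_true, zero_mul, add_zero]
      rw [← mul_sub, mul_pow, ← mul_sub, mul_pow]
      split_ifs <;> ring
    · intro k _ hk
      simp [bumpFrame, hk]
    · simp
  simp only [heq, ← Finset.mul_sum]
  nlinarith [sq_nonneg (lam k₀)]

/-- Minimax lower bound from bumps in one column of a frame with many equal rows. -/
theorem le_minimaxRisk_of_bumpFrame {n p q : ℕ} {kappaStar lamStar : ℝ}
    {U : Matrix (Fin n) (Fin (p + q)) ℝ} (hU : U ∈ stiefel n (p + q)) {lam : Fin (p + q) → ℝ}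
    (hlam : lam ∈ condSet (p + q) kappaStar lamStar) (k₀ : Fin (p + q)) {r b : Fin n}
    (hrb : r ≠ b) {T : Finset (Fin n)} (hT : T.Nonempty) (hrT : r ∉ T) (hbT : b ∉ T)
    (hrow : ∀ a ∈ T, ∀ k, U a k = U r k) (hrowb : ∀ k, U b k = U r k) {α η L : ℝ}
    (hη : 0 ≤ η) (hαη : α ^ 2 + 2 * η ^ 2 = 1) (hL : 0 < L)
    (href : ∀ i j, L ≤ probMatrix (scaled (bumpFrame U k₀ r b α 0) lam) i j ∧
      probMatrix (scaled (bumpFrame U k₀ r b α 0) lam) i j ≤ 1 / 2)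
    (hpos : ∀ a ∈ T, scaled (bumpFrame U k₀ a b α η) lam ∈ latentPositions n p q)
    (hexp : Real.exp (24 / L * (lam k₀ ^ 2 * η ^ 2)) ≤ (T.card : ℝ) / 4) :
    ENNReal.ofReal (η * Real.sqrt (lam k₀) / 8) ≤ minimaxRisk n p q kappaStar lamStar := by
  have hlam0 : ∀ k, 0 ≤ lam k := fun k => (hlam.2.1.trans_le (hlam.2.2.1 k)).le
  have hne : ∀ a ∈ T, a ≠ b := fun a ha h => hbT (h ▸ ha)
  have hne' : ∀ a ∈ T, r ≠ a := fun a ha h => hrT (h ▸ ha)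
  refine le_minimaxRisk_of_separated hT (U := fun a => bumpFrame U k₀ a b α η) (lam := lam)
    (P₀ := probMatrix (scaled (bumpFrame U k₀ r b α 0) lam)) ?_ ?_ ?_ (by positivity) id r ?_ ?_
  · intro a ha
    exact ⟨bumpFrame_mem_stiefel hU k₀ (hne a ha) (fun k => (hrow a ha k).trans (hrowb k).symm) hαη,
      hlam, hpos a ha⟩
  · intro i j
    have := href i j
    constructor <;> linarith
  · intro a ha
    refine ((sum_networkProb_sq_div_le hL href).trans (Real.exp_le_exp.2 ?_)).trans hexp
    have h := sum_sq_probMatrix_bumpFrame_sub_le hU k₀ hlam0 (hne a ha) r b hαη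
    calc _ ≤ 2 / L * (12 * lam k₀ ^ 2 * η ^ 2) := by gcongr
      _ = _ := by ring
  · intro a ha
    exact rowDist_scaled_bumpFrame k₀ lam (hne a ha) (hne' a ha) hrb (hrow a ha) α hη
  -- The bump of hypothesis `s` sits at `s` and `b`, so rows `a` and `r` stay equal.
  · intro s hs a ha hsa
    refine rowDist_scaled_of_eq lam fun k => ?_
    simp [bumpFrame, hrow a ha, hsa.symm, hne a ha, hrb, hne' s hs]

/-! ### A dense leading eigenvector with signed blocks -/

/-- The frame with constant column `0` whose column `k ≥ 1` alternates in sign on the `k`-th block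
of `m` consecutive rows. -/
noncomputable def blockFrame (n d m : ℕ) : Matrix (Fin n) (Fin d) ℝ :=
  fun i k => if (k : ℕ) = 0 then 1 / Real.sqrt n
    else if (i : ℕ) / m = k then (-1) ^ (i : ℕ) / Real.sqrt m else 0

theorem sum_fin_ite_div_eq {n m k : ℕ} (hm : 0 < m) (hk : (k + 1) * m ≤ n) (f : ℕ → ℝ) :
    ∑ i : Fin n, (if (i : ℕ) / m = k then f i else 0) = ∑ j ∈ Finset.range m, f (k * m + j) := by
  rw [Fin.sum_univ_eq_sum_range (fun i => if i / m = k then f i else 0), ← Finset.sum_filter]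
  have h : (Finset.range n).filter (fun i => i / m = k) = Finset.Ico (k * m) ((k + 1) * m) := by
    ext i
    simp only [Finset.mem_filter, Finset.mem_range, Finset.mem_Ico, Nat.div_eq_iff hm]
    rw [add_mul, one_mul] at hk ⊢
    omega
  rw [h, Finset.sum_Ico_eq_sum_range]
  congr 2
  rw [add_mul, one_mul, Nat.add_sub_cancel_left]

theorem sum_range_neg_one_pow {m : ℕ} (hm : Even m) (c : ℕ) :
    ∑ j ∈ Finset.range m, (-1 : ℝ) ^ (c + j) = 0 := by
  simp only [pow_add, ← Finset.mul_sum]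
  rw [neg_one_geom_sum, if_pos hm, mul_zero]

/-- Even block length makes the alternating columns orthogonal to the constant one, and they are
orthogonal to each other because their supports are disjoint. -/
theorem blockFrame_mem_stiefel {n d m : ℕ} (hm : 0 < m) (hme : Even m) (hdm : d * m ≤ n)
    (hn : 0 < n) : blockFrame n d m ∈ stiefel n d := by
  rw [mem_stiefel_iff]
  have hmR : (0 : ℝ) < m := by exact_mod_cast hm
  have hnR : (0 : ℝ) < n := by exact_mod_cast hn
  have hk1 : ∀ k : Fin d, ((k : ℕ) + 1) * m ≤ n := fun k =>
    (Nat.mul_le_mul_right m k.2).trans hdm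
  have hzero : ∀ (k : Fin d) (c : ℝ), ∑ i : Fin n, c *
      (if (i : ℕ) / m = k then (-1) ^ (i : ℕ) / Real.sqrt m else 0) = 0 := by
    intro k c
    rw [← Finset.mul_sum, sum_fin_ite_div_eq hm (hk1 k) (fun i => (-1) ^ i / Real.sqrt m),
      ← Finset.sum_div, sum_range_neg_one_pow hme, zero_div, mul_zero]
  intro k l
  simp only [blockFrame]
  by_cases hk : (k : ℕ) = 0 <;> by_cases hl : (l : ℕ) = 0
  · have hkl : k = l := Fin.ext (hk.trans hl.symm)
    simp only [hl, if_true, hkl]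
    rw [Finset.sum_const, Finset.card_univ, Fintype.card_fin, nsmul_eq_mul]
    have := Real.mul_self_sqrt hnR.le
    field_simp
    linarith
  · have hkl : k ≠ l := fun h => hl (h ▸ hk)
    simp only [hk, hl, if_true, if_false, hkl]
    exact hzero l _
  · have hkl : k ≠ l := fun h => hk (h ▸ hl)
    simp only [hk, hl, if_true, if_false, hkl]
    simpa only [mul_comm] using hzero k (1 / Real.sqrt n)
  · simp only [hk, hl, if_false]
    by_cases hkl : k = l
    · subst hkl
      have h : ∀ i : Fin n, (if (i : ℕ) / m = k then (-1 : ℝ) ^ (i : ℕ) / Real.sqrt m else 0) *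
          (if (i : ℕ) / m = k then (-1) ^ (i : ℕ) / Real.sqrt m else 0) =
          if (i : ℕ) / m = k then 1 / (m : ℝ) else 0 := by
        intro i
        split_ifs
        · rw [div_mul_div_comm, Real.mul_self_sqrt hmR.le, ← mul_pow]
          norm_num
        · simp
      simp only [h, if_true]
      rw [sum_fin_ite_div_eq hm (hk1 k) (fun _ => 1 / (m : ℝ))]
      simp [hmR.ne']
    · rw [if_neg hkl]
      refine Finset.sum_eq_zero fun i _ => ?_
      have hkl' : (k : ℕ) ≠ l := fun h => hkl (Fin.ext h)
      by_cases h1 : (i : ℕ) / m = k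
      · have h2 : (i : ℕ) / m ≠ l := fun h => hkl' (h1.symm.trans h)
        rw [if_neg h2, mul_zero]
      · rw [if_neg h1, zero_mul]

/-- A row lies in a single block and so meets at most one non-constant column. -/
theorem sum_sq_blockFrame_row_le (n m : ℕ) {d : ℕ} (k₁ : Fin d) (hk₁ : (k₁ : ℕ) = 0) (i : Fin n) :
    ∑ k ∈ Finset.univ.erase k₁, blockFrame n d m i k ^ 2 ≤ 1 / m := by
  have h : ∀ k ∈ Finset.univ.erase k₁, blockFrame n d m i k ^ 2
      = if (i : ℕ) / m = k then 1 / (m : ℝ) else 0 := by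
    intro k hk
    have hk0 : (k : ℕ) ≠ 0 := fun h => Finset.ne_of_mem_erase hk (Fin.ext (h.trans hk₁.symm))
    simp only [blockFrame, hk0, if_false]
    split_ifs
    · rw [div_pow, ← pow_mul, mul_comm, pow_mul, Real.sq_sqrt (Nat.cast_nonneg m)]
      norm_num
    · norm_num
  rw [Finset.sum_congr rfl h]
  by_cases hd : (i : ℕ) / m < d
  · refine (Finset.sum_le_univ_sum_of_nonneg fun k => ?_).trans (le_of_eq ?_)
    · split_ifs <;> positivity
    · rw [Finset.sum_eq_single ⟨(i : ℕ) / m, hd⟩]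
      · simp
      · intro k _ hk
        exact if_neg fun h => hk (Fin.ext h.symm)
      · simp
  · rw [Finset.sum_eq_zero fun k _ => if_neg fun h => hd (lt_of_eq_of_lt h k.2)]
    positivity

/-- Small rows beyond the constant leading column keep the edge probabilities comparable to the
contribution of that column. -/
theorem probMatrix_bounds_of_row {n p q : ℕ} {V : Matrix (Fin n) (Fin (p + q)) ℝ}
    {k₁ : Fin (p + q)} (hk₁ : (k₁ : ℕ) < p) {lam : Fin (p + q) → ℝ} {kap ell : ℝ}
    (hell : 0 < ell) (hkap : 0 ≤ kap) (h1 : lam k₁ = kap * ell) (h2 : ∀ k, k ≠ k₁ → lam k = ell)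
    (hV : ∀ i, V i k₁ = 1 / Real.sqrt n)
    (hrow : ∀ i, ∑ k ∈ Finset.univ.erase k₁, V i k ^ 2 ≤ kap / (2 * n)) (i j : Fin n) :
    kap * ell / (2 * n) ≤ probMatrix (scaled V lam) i j ∧
      probMatrix (scaled V lam) i j ≤ 3 * (kap * ell) / (2 * n) := by
  have hlam : ∀ k, 0 ≤ lam k := by
    intro k
    by_cases hk : k = k₁
    · rw [hk, h1]; positivity
    · rw [h2 k hk]; exact hell.le
  have hn : (0 : ℝ) < n := by exact_mod_cast i.pos
  rw [probMatrix_scaled_apply V hlam, ← Finset.add_sum_erase _ _ (Finset.mem_univ k₁),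
    if_pos hk₁, one_mul, h1, hV, hV]
  set S := ∑ k ∈ Finset.univ.erase k₁,
    (if (k : ℕ) < p then (1 : ℝ) else -1) * (lam k * (V i k * V j k)) with hS
  have hlead : kap * ell * (1 / Real.sqrt n * (1 / Real.sqrt n)) = kap * ell / n := by
    rw [div_mul_div_comm, Real.mul_self_sqrt hn.le]
    ring
  -- `|xy| ≤ (x² + y²)/2` makes the signature irrelevant: the remaining columns contribute at most
  -- half of the leading term.
  have habs : |S| ≤ kap * ell / (2 * n) := by
    calc |S| ≤ ∑ k ∈ Finset.univ.erase k₁, ell * ((V i k ^ 2 + V j k ^ 2) / 2) := by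
          refine (Finset.abs_sum_le_sum_abs _ _).trans (Finset.sum_le_sum fun k hk => ?_)
          rw [h2 k (Finset.ne_of_mem_erase hk)]
          have h3 : |(if (k : ℕ) < p then (1 : ℝ) else -1)| = 1 := by split_ifs <;> simp
          rw [abs_mul, h3, one_mul, abs_mul, abs_of_pos hell]
          refine mul_le_mul_of_nonneg_left (abs_le.2 ⟨?_, ?_⟩) hell.le <;>
            nlinarith [sq_nonneg (V i k + V j k), sq_nonneg (V i k - V j k)]
      _ = ell * ((∑ k ∈ Finset.univ.erase k₁, V i k ^ 2 +
            ∑ k ∈ Finset.univ.erase k₁, V j k ^ 2) / 2) := by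
          rw [← Finset.mul_sum, ← Finset.sum_div, Finset.sum_add_distrib]
      _ ≤ ell * ((kap / (2 * n) + kap / (2 * n)) / 2) := by
          gcongr
          · exact hrow i
          · exact hrow j
      _ = _ := by ring
  rw [hlead]
  have e1 : kap * ell / n = 2 * (kap * ell / (2 * n)) := by field_simp
  have e2 : 3 * (kap * ell) / (2 * n) = 3 * (kap * ell / (2 * n)) := by ring
  have := abs_le.1 habs
  rw [e1, e2]
  constructor <;> linarith

/-- Rows `a` and `b` vanish off `k₁` before the bump, so only `±η` appears there; in all other rows
entries can only shrink. -/
theorem sum_sq_bumpFrame_row_le {n d : ℕ} {U : Matrix (Fin n) (Fin d) ℝ} {k₀ k₁ : Fin d}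
    (hk : k₀ ≠ k₁) {a b : Fin n} (hab : a ≠ b) (ha : ∀ k, k ≠ k₁ → U a k = 0)
    (hb : ∀ k, k ≠ k₁ → U b k = 0) {α η ρ : ℝ} (hα : α ^ 2 ≤ 1) (hη : η ^ 2 ≤ ρ)
    (hrow : ∀ i, ∑ k ∈ Finset.univ.erase k₁, U i k ^ 2 ≤ ρ) (i : Fin n) :
    ∑ k ∈ Finset.univ.erase k₁, bumpFrame U k₀ a b α η i k ^ 2 ≤ ρ := by
  by_cases hi : i = a ∨ i = b
  · have hUi : ∀ k, k ≠ k₁ → U i k = 0 := by rcases hi with rfl | rfl <;> assumption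
    rw [Finset.sum_eq_single_of_mem k₀ (Finset.mem_erase.2 ⟨hk, Finset.mem_univ _⟩)]
    · rcases hi with rfl | rfl
      · simpa [bumpFrame, ha k₀ hk, hab] using hη
      · simpa [bumpFrame, hb k₀ hk, hab.symm] using hη
    · intro k hk' hk0
      simp [bumpFrame, hk0, hUi k (Finset.ne_of_mem_erase hk')]
  · push Not at hi
    refine (Finset.sum_le_sum fun k _ => ?_).trans (hrow i)
    simp only [bumpFrame, hi.1, hi.2, if_false]
    split_ifs
    · nlinarith [sq_nonneg (U i k)]
    · exact le_rfl

theorem blockFrame_apply_zero {n d m : ℕ} {k : Fin d} (hk : (k : ℕ) = 0) (i : Fin n) :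
    blockFrame n d m i k = 1 / Real.sqrt n := by
  simp [blockFrame, hk]

/-- Block `0` belongs to no column, which leaves room for the fixed rows `r` and `b`; the rows past
all blocks supply the bump positions. -/
theorem blockFrame_apply_eq_zero {n d m : ℕ} (hm : 0 < m) {i : Fin n}
    (hi : (i : ℕ) < m ∨ d * m ≤ (i : ℕ)) {k : Fin d} (hk : (k : ℕ) ≠ 0) :
    blockFrame n d m i k = 0 := by
  have h : (i : ℕ) / m ≠ k := by
    rcases hi with hi | hi
    · rw [Nat.div_eq_of_lt hi]
      exact hk.symm
    · have h1 := (Nat.le_div_iff_mul_le hm).2 hi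
      have h2 := k.2
      omega
  simp [blockFrame, hk, h]

/-! ### Choice of parameters and the minimax bounds for `d ≥ 2` and `d = 1`. -/

theorem exp_le_quarter_of_le_log {n : ℕ} (hn : 256 ≤ n) {s c x : ℝ} (hs : 0 ≤ s)
    (hslog : s ≤ Real.log n) (hc : c ≤ 1 / 2) (hx : (n : ℝ) / 4 ≤ x) :
    Real.exp (c * s) ≤ x / 4 := by
  have hnR : (256 : ℝ) ≤ n := by exact_mod_cast hn
  have h1 : Real.exp (c * s) ≤ Real.sqrt n := by
    rw [← Real.exp_log (Real.sqrt_pos.2 (by linarith : (0 : ℝ) < n)),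
      Real.log_sqrt (by linarith)]
    apply Real.exp_le_exp.2
    nlinarith
  -- Equivalent to `n ≥ 256`, the source of that threshold.
  have h2 : Real.sqrt n ≤ n / 16 := by
    rw [Real.sqrt_le_left (by linarith)]
    nlinarith
  linarith

theorem le_minimaxRisk_of_two_le {n p q : ℕ} {kap ell : ℝ} (hp : 1 ≤ p) (hd : 2 ≤ p + q)
    (hell : 0 < ell) (hkap : 3 * ((p + q : ℕ) : ℝ) ≤ kap) (hkl : 3 * kap * ell ≤ n)
    (hkn : 8 * kap ≤ n) (hn : 256 ≤ n) :
    ENNReal.ofReal (Real.sqrt (kap * min ell (Real.log n) / n) / 80)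
      ≤ minimaxRisk n p q kap ell := by
  have hnR : (256 : ℝ) ≤ n := by exact_mod_cast hn
  have hn0 : (0 : ℝ) < n := by linarith
  have hdR : (2 : ℝ) ≤ ((p + q : ℕ) : ℝ) := by exact_mod_cast hd
  have hkap0 : 0 < kap := by linarith
  have hlog : 0 < Real.log n := Real.log_pos (by linarith)
  set s := min ell (Real.log n) with hs
  have hs0 : 0 < s := lt_min hell hlog
  have hsell : s ≤ ell := min_le_left _ _
  -- block size
  set h := ⌈(n : ℝ) / kap⌉₊ with hh
  have hh1 : (n : ℝ) / kap ≤ h := Nat.le_ceil _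
  have hh2 : (h : ℝ) < n / kap + 1 := Nat.ceil_lt_add_one (by positivity)
  have hhpos : 0 < h := Nat.ceil_pos.2 (by positivity)
  set m := 2 * h with hm
  have hmR : (m : ℝ) = 2 * h := by rw [hm]; push_cast; ring
  have hm0 : 0 < m := by omega
  have hinv : 1 / (m : ℝ) ≤ kap / (2 * n) := by
    rw [hmR, div_le_div_iff₀ (by positivity) (by positivity)]
    rw [div_le_iff₀ hkap0] at hh1
    linarith
  -- `d ≤ κ/3` and `m ≤ 2(n/κ + 1)` give `dm ≤ (2/3)(n + κ)`, and `8κ ≤ n` turns this into `3n/4`.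
  -- At least a quarter of the rows stay free.
  have hdm : (((p + q) * m : ℕ) : ℝ) ≤ 3 / 4 * n := by
    rw [Nat.cast_mul, hmR]
    have h1 : (h : ℝ) * kap ≤ n + kap := by
      have := mul_le_mul_of_nonneg_right hh2.le hkap0.le
      rwa [add_mul, div_mul_cancel₀ _ hkap0.ne', one_mul] at this
    have h2 : ((p + q : ℕ) : ℝ) * (2 * h) ≤ kap / 3 * (2 * h) := by
      gcongr
      linarith
    nlinarith
  have hdmn : (p + q) * m < n := by
    have : (((p + q) * m : ℕ) : ℝ) < n := by linarith
    exact_mod_cast this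
  have hmdm : m ≤ (p + q) * m := Nat.le_mul_of_pos_left _ (by omega)
  -- size of the bump
  obtain ⟨η, hη0, hη⟩ : ∃ η : ℝ, 0 ≤ η ∧ η ^ 2 = kap * s / (100 * ell * n) :=
    ⟨_, Real.sqrt_nonneg _, Real.sq_sqrt (by positivity)⟩
  have hηle : η ^ 2 ≤ kap / (100 * n) := by
    rw [hη, div_le_div_iff₀ (by positivity) (by positivity)]
    nlinarith [mul_le_mul_of_nonneg_left hsell (by positivity : 0 ≤ kap * (100 * n))]
  have hkn' : kap / n ≤ 1 / 8 := by rw [div_le_iff₀ hn0]; linarith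
  have e1 : kap / (100 * n) = kap / n / 100 := by rw [div_div, mul_comm]
  have e2 : kap / (2 * n) = kap / n / 2 := by rw [div_div, mul_comm]
  have hkn0 : 0 < kap / n := by positivity
  have hηle' : η ^ 2 ≤ kap / (2 * n) := by linarith
  obtain ⟨α, hα⟩ : ∃ α : ℝ, α ^ 2 = 1 - 2 * η ^ 2 := ⟨_, Real.sq_sqrt (by linarith)⟩
  have hα1 : α ^ 2 ≤ 1 := by nlinarith [sq_nonneg η]
  -- the frame
  set U := blockFrame n (p + q) m with hU
  have hUs : U ∈ stiefel n (p + q) :=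
    blockFrame_mem_stiefel hm0 (even_two_mul h) hdmn.le (by omega)
  set k₁ : Fin (p + q) := ⟨0, by omega⟩ with hk₁
  set k₀ : Fin (p + q) := ⟨1, by omega⟩ with hk₀
  set r : Fin n := ⟨0, by omega⟩ with hr
  set b : Fin n := ⟨1, by omega⟩ with hb
  set T : Finset (Fin n) := Finset.Ici ⟨(p + q) * m, hdmn⟩ with hT
  have hk01 : k₀ ≠ k₁ := by simp [hk₀, hk₁]
  have hrb : r ≠ b := by simp [hr, hb]
  have hmem : ∀ a ∈ T, (p + q) * m ≤ (a : ℕ) := fun a ha => by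
    simpa [hT, Fin.le_def] using ha
  have hcard : (n : ℝ) / 4 ≤ (T.card : ℝ) := by
    rw [hT, Fin.card_Ici, Nat.cast_sub hdmn.le]
    linarith
  have hrT : r ∉ T := fun hmr => by
    have := hmem r hmr
    simp only [hr] at this
    omega
  have hbT : b ∉ T := fun hmb => by
    have := hmem b hmb
    simp only [hb] at this
    omega
  have hne0 : ∀ k, k ≠ k₁ → (k : ℕ) ≠ 0 := fun k hk h => hk (Fin.ext h)
  have hUr : ∀ k, k ≠ k₁ → U r k = 0 := fun k hk =>
    blockFrame_apply_eq_zero hm0 (Or.inl hm0) (hne0 k hk)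
  -- Row `1` is still in block `0` because `m = 2h ≥ 2`.
  have hUb : ∀ k, k ≠ k₁ → U b k = 0 := fun k hk =>
    blockFrame_apply_eq_zero hm0 (Or.inl (by simp only [hb]; omega)) (hne0 k hk)
  have hUT : ∀ a ∈ T, ∀ k, k ≠ k₁ → U a k = 0 := fun a ha k hk =>
    blockFrame_apply_eq_zero hm0 (Or.inr (hmem a ha)) (hne0 k hk)
  have hU1 : ∀ i, U i k₁ = 1 / Real.sqrt n := fun i => blockFrame_apply_zero rfl i
  have hrows : ∀ {i j : Fin n}, (∀ k, k ≠ k₁ → U i k = 0) → (∀ k, k ≠ k₁ → U j k = 0) →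
      ∀ k, U i k = U j k := by
    intro i j hi hj k
    by_cases hk : k = k₁
    · rw [hk, hU1, hU1]
    · rw [hi k hk, hj k hk]
  have hUrow : ∀ i, ∑ k ∈ Finset.univ.erase k₁, U i k ^ 2 ≤ kap / (2 * n) := fun i =>
    (sum_sq_blockFrame_row_le n m k₁ rfl i).trans hinv
  -- the eigenvalues
  set lam : Fin (p + q) → ℝ := fun k => if k = k₁ then kap * ell else ell with hlam
  have hlk₁ : lam k₁ = kap * ell := if_pos rfl
  have hlk : ∀ k, k ≠ k₁ → lam k = ell := fun k hk => if_neg hk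
  have hkell : ell ≤ kap * ell := by nlinarith
  have hlam1 : ∀ k, ell ≤ lam k := fun k => by
    simp only [hlam]; split_ifs <;> linarith
  have hlam2 : ∀ k, lam k ≤ kap * ell := fun k => by
    simp only [hlam]; split_ifs <;> linarith
  have hcond : lam ∈ condSet (p + q) kap ell := by
    refine ⟨fun i j hij => ?_, hell, hlam1, fun i j => ?_⟩
    · by_cases hi : i = k₁
      · rw [hi, hlk₁]; exact hlam2 j
      · have hj : j ≠ k₁ := fun hj => hi (le_antisymm (hj ▸ hij) (Nat.zero_le _))
        rw [hlk i hi, hlk j hj]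
    · rw [div_le_iff₀ (hell.trans_le (hlam1 j))]
      exact (hlam2 i).trans (mul_le_mul_of_nonneg_left (hlam1 j) hkap0.le)
  have hkl' : 3 * (kap * ell) / (2 * n) ≤ 1 / 2 := by
    rw [div_le_iff₀ (by positivity)]
    linarith
  have hbound : ∀ (a : Fin n) (η' : ℝ), a ≠ b → (∀ k, k ≠ k₁ → U a k = 0) →
      η' ^ 2 ≤ kap / (2 * n) → ∀ i j,
      kap * ell / (2 * n) ≤ probMatrix (scaled (bumpFrame U k₀ a b α η') lam) i j ∧
      probMatrix (scaled (bumpFrame U k₀ a b α η') lam) i j ≤ 1 / 2 := by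
    intro a η' hab ha hη' i j
    have := probMatrix_bounds_of_row (V := bumpFrame U k₀ a b α η') (k₁ := k₁) hp hell hkap0.le
      hlk₁ hlk (fun i => by simp [bumpFrame, hk01.symm, hU1])
      (sum_sq_bumpFrame_row_le hk01 hab ha hUb hα1 hη' hUrow) i j
    exact ⟨this.1, this.2.trans hkl'⟩
  have hL : 0 < kap * ell / (2 * n) := by positivity
  have hmain := le_minimaxRisk_of_bumpFrame hUs hcond k₀ hrb (T := T)
    ⟨_, Finset.mem_Ici.2 le_rfl⟩ hrT hbT (fun a ha => hrows (hUT a ha) hUr) (hrows hUb hUr) hη0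
    (by linarith) hL (hbound r 0 hrb hUr (by rw [zero_pow two_ne_zero]; positivity)) ?_ ?_
  · refine le_trans (ENNReal.ofReal_le_ofReal (le_of_eq ?_)) hmain
    have : η * Real.sqrt (lam k₀) = Real.sqrt (kap * s / n) / 10 := by
      rw [hlk k₀ hk01, ← Real.sqrt_sq hη0, ← Real.sqrt_mul (sq_nonneg η), hη]
      rw [eq_div_iff (by norm_num : (10 : ℝ) ≠ 0),
        show (10 : ℝ) = Real.sqrt (10 ^ 2) by rw [Real.sqrt_sq]; norm_num,
        ← Real.sqrt_mul (by positivity)]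
      congr 1
      field_simp
      norm_num
    rw [this]
    ring
  · intro a ha i j
    obtain ⟨h1, h2⟩ := hbound a η (fun h => hbT (h ▸ ha)) (hUT a ha) hηle' i j
    constructor <;> linarith
  -- The `100` in `η²` keeps this coefficient below the `1/2` allowed by `exp_le_quarter_of_le_log`.
  · have : 24 / (kap * ell / (2 * n)) * (lam k₀ ^ 2 * η ^ 2) = 48 / 100 * s := by
      rw [hlk k₀ hk01, hη]
      field_simp
      norm_num
    rw [this]
    exact exp_le_quarter_of_le_log hn hs0.le (min_le_right _ _) (by norm_num) hcard

/-- The constant column with entries `x = 1/√n` carries the bump itself. Taking `η ≤ x/30` keeps its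
entries between `x/4` and `2x`, so the probabilities lie between `ℓ/(16n)` and `4ℓ/n ≤ 4/9`. -/
theorem le_minimaxRisk_of_eq_one {n p q : ℕ} {kap ell : ℝ} (hp : 1 ≤ p) (hd : p + q = 1)
    (hell : 0 < ell) (hkap : 1 ≤ kap) (hln : 9 * ell ≤ n) (hn : 256 ≤ n) :
    ENNReal.ofReal (Real.sqrt (min ell (Real.log n) / n) / 240)
      ≤ minimaxRisk n p q kap ell := by
  obtain rfl : p = 1 := by omega
  obtain rfl : q = 0 := by omega
  have hnR : (256 : ℝ) ≤ n := by exact_mod_cast hn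
  have hn0 : (0 : ℝ) < n := by linarith
  have hlog : 0 < Real.log n := Real.log_pos (by linarith)
  set s := min ell (Real.log n) with hs
  have hs0 : 0 < s := lt_min hell hlog
  have hsell : s ≤ ell := min_le_left _ _
  obtain ⟨x, hx0, hx⟩ : ∃ x : ℝ, 0 < x ∧ x ^ 2 = 1 / n :=
    ⟨1 / Real.sqrt n, by positivity, by rw [div_pow, Real.sq_sqrt hn0.le, one_pow]⟩
  obtain ⟨η, hη0, hη⟩ : ∃ η : ℝ, 0 ≤ η ∧ η ^ 2 = s / (900 * ell * n) :=
    ⟨_, Real.sqrt_nonneg _, Real.sq_sqrt (by positivity)⟩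
  have hηle : η ^ 2 ≤ (x / 30) ^ 2 := by
    rw [hη, div_pow, hx, div_div, div_le_div_iff₀ (by positivity) (by positivity)]
    nlinarith [mul_le_mul_of_nonneg_left hsell (by positivity : 0 ≤ (900 : ℝ) * n)]
  have hηx : η ≤ x / 30 := by
    have := Real.sqrt_le_sqrt hηle
    rwa [Real.sqrt_sq hη0, Real.sqrt_sq (by positivity)] at this
  have hxle : x ^ 2 ≤ 1 / 256 := by
    rw [hx]
    exact one_div_le_one_div_of_le (by norm_num) hnR
  obtain ⟨α, hα0, hα⟩ : ∃ α : ℝ, 0 ≤ α ∧ α ^ 2 = 1 - 2 * η ^ 2 :=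
    ⟨_, Real.sqrt_nonneg _, Real.sq_sqrt (by nlinarith)⟩
  have hα1 : α ≤ 1 := by nlinarith [sq_nonneg η]
  have hα2 : 1 / 2 ≤ α := by nlinarith
  set U : Matrix (Fin n) (Fin (1 + 0)) ℝ := fun _ _ => x with hU
  have hUs : U ∈ stiefel n (1 + 0) := by
    rw [mem_stiefel_iff]
    intro k l
    obtain rfl : k = l := Subsingleton.elim (α := Fin 1) k l
    simp only [hU, if_true]
    rw [Finset.sum_const, Finset.card_univ, Fintype.card_fin, nsmul_eq_mul, ← sq, hx]
    field_simp
  set r : Fin n := ⟨0, by omega⟩ with hr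
  set b : Fin n := ⟨1, by omega⟩ with hb
  have hrb : r ≠ b := by simp [hr, hb]
  set T : Finset (Fin n) := Finset.Ici ⟨2, by omega⟩ with hT
  have hmem : ∀ a ∈ T, 2 ≤ (a : ℕ) := fun a ha => by
    simpa [hT, Fin.le_def] using ha
  have hrT : r ∉ T := fun h => by
    have := hmem r h
    simp [hr] at this
  have hbT : b ∉ T := fun h => by
    have := hmem b h
    simp [hb] at this
  have hcard : (n : ℝ) / 4 ≤ (T.card : ℝ) := by
    rw [hT, Fin.card_Ici, Nat.cast_sub (by simp only; omega)]
    push_cast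
    linarith
  have hcond : (fun _ => ell : Fin (1 + 0) → ℝ) ∈ condSet (1 + 0) kap ell :=
    ⟨fun _ _ _ => le_rfl, hell, fun _ => le_rfl, fun _ _ => by rwa [div_self hell.ne']⟩
  have hprob : ∀ (V : Matrix (Fin n) (Fin (1 + 0)) ℝ) (i j : Fin n),
      probMatrix (scaled V fun _ => ell) i j = ell * (V i 0 * V j 0) := by
    intro V i j
    rw [probMatrix_scaled_apply V fun _ => hell.le]
    simp
  have hellx : ell * x ^ 2 ≤ 1 / 9 := by
    rw [hx, mul_one_div, div_le_iff₀ hn0]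
    linarith
  have hentry : ∀ (a : Fin n) (η' : ℝ), a ≠ b → 0 ≤ η' → η' ≤ x / 30 → ∀ i,
      x / 4 ≤ bumpFrame U 0 a b α η' i 0 ∧ bumpFrame U 0 a b α η' i 0 ≤ 2 * x := by
    intro a η' hab h0 h1 i
    simp only [bumpFrame, hU, if_true]
    have h2 : x / 2 ≤ α * x := by nlinarith
    have h3 : α * x ≤ x := by nlinarith
    split_ifs <;> constructor <;> linarith
  have hbound : ∀ (a : Fin n) (η' : ℝ), a ≠ b → 0 ≤ η' → η' ≤ x / 30 → ∀ i j,
      ell / (16 * n) ≤ probMatrix (scaled (bumpFrame U 0 a b α η') fun _ => ell) i j ∧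
      probMatrix (scaled (bumpFrame U 0 a b α η') fun _ => ell) i j ≤ 1 / 2 := by
    intro a η' hab h0 h1 i j
    obtain ⟨hi1, hi2⟩ := hentry a η' hab h0 h1 i
    obtain ⟨hj1, hj2⟩ := hentry a η' hab h0 h1 j
    rw [hprob]
    have hl : x / 4 * (x / 4) ≤ bumpFrame U 0 a b α η' i 0 * bumpFrame U 0 a b α η' j 0 := by
      gcongr
      linarith
    have hu : bumpFrame U 0 a b α η' i 0 * bumpFrame U 0 a b α η' j 0 ≤ 2 * x * (2 * x) := by
      gcongr
      linarith
    constructor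
    · calc ell / (16 * n) = ell * (x / 4 * (x / 4)) := by
            rw [show x / 4 * (x / 4) = x ^ 2 / 16 by ring, hx]
            field_simp
        _ ≤ _ := by gcongr
    · calc _ ≤ ell * (2 * x * (2 * x)) := by gcongr
        _ = 4 * (ell * x ^ 2) := by ring
        _ ≤ 1 / 2 := by linarith
  have hL : 0 < ell / (16 * n) := by positivity
  have hmain := le_minimaxRisk_of_bumpFrame hUs hcond 0 hrb (T := T)
    ⟨_, Finset.mem_Ici.2 le_rfl⟩ hrT hbT (fun _ _ _ => rfl) (fun _ => rfl) hη0 (by linarith)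
    hL (hbound r 0 hrb le_rfl (by positivity)) ?_ ?_
  · refine le_trans (ENNReal.ofReal_le_ofReal (le_of_eq ?_)) hmain
    have : η * Real.sqrt ell = Real.sqrt (s / n) / 30 := by
      rw [← Real.sqrt_sq hη0, ← Real.sqrt_mul (sq_nonneg η), hη]
      rw [eq_div_iff (by norm_num : (30 : ℝ) ≠ 0),
        show (30 : ℝ) = Real.sqrt (30 ^ 2) by rw [Real.sqrt_sq]; norm_num,
        ← Real.sqrt_mul (by positivity)]
      congr 1
      field_simp
      norm_num
    rw [this]
    ring
  · intro a ha i j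
    obtain ⟨h1, h2⟩ := hbound a η (fun h => hbT (h ▸ ha)) hη0 hηx i j
    constructor <;> linarith
  · have : 24 / (ell / (16 * n)) * (ell ^ 2 * η ^ 2) = 384 / 900 * s := by
      rw [hη]
      field_simp
      norm_num
    rw [this]
    exact exp_le_quarter_of_le_log hn hs0.le (min_le_right _ _) (by norm_num) hcard

end LowRankNetwork

theorem theorem1 (p q : ℕ → ℕ) (kappaStar lamStar : ℕ → ℝ)
    (hp : ∀ᶠ n in atTop, 1 ≤ p n)
    (hlam : ∀ᶠ n in atTop, 0 < lamStar n)
    (hkappa_o : kappaStar =o[atTop] fun n : ℕ => (n : ℝ))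
    (hkappa_d : ∀ᶠ n in atTop, 3 * ((p n + q n : ℕ) : ℝ) ≤ kappaStar n)
    (hkappa_lam : ∀ᶠ n : ℕ in atTop, 3 * kappaStar n * lamStar n ≤ (n : ℝ))
    (hd_one : ∃ K : ℝ, ∀ᶠ n in atTop, p n + q n = 1 → kappaStar n ≤ K) :
    ∃ c : ℝ, 0 < c ∧ ∀ᶠ n : ℕ in atTop,
      ENNReal.ofReal
          (c * Real.sqrt (kappaStar n * min (lamStar n) (Real.log (n : ℝ)) / (n : ℝ)))
        ≤ LowRankNetwork.minimaxRisk n (p n) (q n) (kappaStar n) (lamStar n) := by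
  obtain ⟨K, hK⟩ := hd_one
  set K' := max K 1 with hK'
  have hK1 : 1 ≤ K' := le_max_right _ _
  have hK0 : 0 < K' := by linarith
  have hsK : 1 ≤ Real.sqrt K' := Real.one_le_sqrt.2 hK1
  -- The factor `√K'` absorbs the missing `κ` when `d = 1`; since `K' ≥ 1`, the constant is also
  -- below the `1/80` of the case `d ≥ 2`.
  refine ⟨1 / (240 * Real.sqrt K'), by positivity, ?_⟩
  -- Of `κ = o(n)` only `8κ ≤ n` is needed.
  filter_upwards [hp, hlam, hkappa_o.bound (by norm_num : (0 : ℝ) < 1 / 8), hkappa_d, hkappa_lam,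
    hK, eventually_ge_atTop 256] with n hp hlam hko hkd hkl hK hn
  have hnR : (256 : ℝ) ≤ n := by exact_mod_cast hn
  have hlog : 0 < Real.log n := Real.log_pos (by linarith)
  have hd1 : (1 : ℝ) ≤ ((p n + q n : ℕ) : ℝ) := by exact_mod_cast (by omega : 1 ≤ p n + q n)
  have hkn : 8 * kappaStar n ≤ n := by
    rw [Real.norm_eq_abs, Real.norm_eq_abs, abs_of_nonneg (by linarith : (0 : ℝ) ≤ n)] at hko
    linarith [le_abs_self (kappaStar n)]
  rcases (by omega : p n + q n = 1 ∨ 2 ≤ p n + q n) with hd | hd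
  · refine le_trans (ENNReal.ofReal_le_ofReal ?_) (LowRankNetwork.le_minimaxRisk_of_eq_one hp hd
      hlam (by linarith) (by nlinarith) hn)
    have hle : Real.sqrt (kappaStar n * min (lamStar n) (Real.log n) / n)
        ≤ Real.sqrt K' * Real.sqrt (min (lamStar n) (Real.log n) / n) := by
      rw [← Real.sqrt_mul hK0.le, mul_div_assoc]
      have : 0 ≤ min (lamStar n) (Real.log n) := le_min hlam.le hlog.le
      exact Real.sqrt_le_sqrt (by gcongr; exact (hK hd).trans (le_max_left _ _))
    calc _ ≤ 1 / (240 * Real.sqrt K') *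
          (Real.sqrt K' * Real.sqrt (min (lamStar n) (Real.log n) / n)) := by gcongr
      _ = _ := by field_simp
  · refine le_trans (ENNReal.ofReal_le_ofReal ?_) (LowRankNetwork.le_minimaxRisk_of_two_le hp hd
      hlam hkd hkl hkn hn)
    have hc : 1 / (240 * Real.sqrt K') ≤ 1 / 80 :=
      one_div_le_one_div_of_le (by norm_num) (by linarith)
    calc _ ≤ 1 / 80 * Real.sqrt (kappaStar n * min (lamStar n) (Real.log n) / n) := by gcongr
      _ = _ := by ring
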